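/- For a positive integer $n$, let $A_n$ be the $n\times n$ real matrix with entries $(A_n)_{ij}=(j-i)^2$ for $1\le i,j\le n$ (the Euclidean distance matrix of $1,2,\dots,n$), let $I_n$ be the $n\times n$ identity matrix, and let $f(n)=\frac{1}{6}n(n^2-1)$. A real $n\times n$ matrix $M$ is called completely positive if $M=BB^T$ for some entrywise non-negative real $n\times k$ matrix $B$ and some $k$. **Theorem.** For every integer $n\ge 1$, the matrix $B_n:=A_n+f(n)I_n$ is completely positive. Moreover, $f(n)$ is optimal: $f(n)$ is the least real number $c$ for which $A_n+cI_n$ is positive semidefinite, and it is also the least real number $c$ for which $A_n+cI_n$ is completely positive. -/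

import Mathlib

/-- A real `n × n` matrix `M` is completely positive if `M = B * Bᵀ` for some entrywise
non-negative real matrix `B` with `n` rows and finitely many columns. -/
def IsCompletelyPositive {n : ℕ} (M : Matrix (Fin n) (Fin n) ℝ) : Prop :=
  ∃ (k : ℕ) (B : Matrix (Fin n) (Fin k) ℝ), (∀ i j, 0 ≤ B i j) ∧ M = B * B.transpose

/-- The Euclidean distance matrix of `1, 2, …, n`, with entries `(j - i) ^ 2`.
Indices in `Fin n` run from `0` to `n - 1`; the index `i` stands for the point `i + 1`. -/
def distMatrix (n : ℕ) : Matrix (Fin n) (Fin n) ℝ :=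
  Matrix.of fun i j => ((((j : ℕ) : ℝ) + 1) - (((i : ℕ) : ℝ) + 1)) ^ 2

/-- The shift `f(n) = n (n² - 1) / 6`, computed in the real numbers. -/
noncomputable def optimalShift (n : ℕ) : ℝ := (n : ℝ) * ((n : ℝ) ^ 2 - 1) / 6

/-- The matrix `B_n = A_n + f(n) I_n`. -/
noncomputable def shiftedDistMatrix (n : ℕ) : Matrix (Fin n) (Fin n) ℝ :=
  distMatrix n + optimalShift n • (1 : Matrix (Fin n) (Fin n) ℝ)

/-! Translate the points to a family `x` symmetric about `0`. Odd power sums vanish, so `x` is an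
eigenvector of `distMatrix n` with eigenvalue `-2 * ∑ x k ^ 2 = -optimalShift n`; for `n > 1` it is
nonzero and gives optimality.

The shifted matrix `M` annihilates `x`, so every column of a non-negative factor must be orthogonal
to `x`, balancing coordinates of opposite signs. `tripleSum` is a weighted sum of rank-one matrices
of such vectors, each supported on at most three indices. Divided by `4 * ∑ |x q| ^ 3`, it agrees
with `M` off the diagonal where signs do not oppose, and is at most `M` where they do
(`cross_sum_le`). `IsCompletelyPositive.of_le` fills the deficit with two-point vectors orthogonal
to `x`; what remains is diagonal and annihilates `x`, so it vanishes wherever `x j ≠ 0`. -/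

theorem ite_ite_eq_mul_ite (P Q : Prop) [Decidable P] [Decidable Q] (t : ℝ) :
    (if P then if Q then t else 0 else 0) = t * (if P then 1 else 0) * (if Q then 1 else 0) := by
  split_ifs <;> simp

theorem ite_mul_ite_of_ne {ι : Type*} [DecidableEq ι] {j k : ι} (hjk : j ≠ k) (r : ι) :
    (if r = j then (1 : ℝ) else 0) * (if r = k then 1 else 0) = 0 := by
  split_ifs with h1 h2
  · exact absurd (h1.symm.trans h2) hjk
  all_goals simp

/-! ### Closure properties of completely positive matrices and a comparison criterion. -/

namespace IsCompletelyPositive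

variable {n : ℕ}

theorem of_fintype {ι : Type*} [Fintype ι] {M : Matrix (Fin n) (Fin n) ℝ}
    (B : Matrix (Fin n) ι ℝ) (hB : ∀ i j, 0 ≤ B i j) (hM : M = B * B.transpose) :
    IsCompletelyPositive M := by
  refine ⟨Fintype.card ι, B.submatrix id (Fintype.equivFin ι).symm, fun i j => hB _ _, ?_⟩
  rw [hM, Matrix.transpose_submatrix, Matrix.submatrix_mul_equiv, Matrix.submatrix_id_id]

theorem add {M N : Matrix (Fin n) (Fin n) ℝ} (hM : IsCompletelyPositive M)
    (hN : IsCompletelyPositive N) : IsCompletelyPositive (M + N) := by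
  obtain ⟨k, B, hB, rfl⟩ := hM
  obtain ⟨l, C, hC, rfl⟩ := hN
  refine of_fintype (Matrix.fromCols B C) ?_ ?_
  · rintro i (j | j)
    · exact hB i j
    · exact hC i j
  · rw [Matrix.transpose_fromCols, Matrix.fromCols_mul_fromRows]

theorem zero : IsCompletelyPositive (0 : Matrix (Fin n) (Fin n) ℝ) :=
  ⟨0, 0, fun _ _ => le_rfl, by simp⟩

theorem sum {ι : Type*} (s : Finset ι) {M : ι → Matrix (Fin n) (Fin n) ℝ}
    (h : ∀ i ∈ s, IsCompletelyPositive (M i)) : IsCompletelyPositive (∑ i ∈ s, M i) :=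
  Finset.sum_induction M IsCompletelyPositive (fun _ _ => add) zero h

theorem smul {c : ℝ} (hc : 0 ≤ c) {M : Matrix (Fin n) (Fin n) ℝ} (hM : IsCompletelyPositive M) :
    IsCompletelyPositive (c • M) := by
  obtain ⟨k, B, hB, rfl⟩ := hM
  refine ⟨k, √c • B, fun i j => mul_nonneg (Real.sqrt_nonneg c) (hB i j), ?_⟩
  rw [Matrix.transpose_smul, Matrix.smul_mul, Matrix.mul_smul, smul_smul, Real.mul_self_sqrt hc]

theorem vecMulVec {v : Fin n → ℝ} (hv : ∀ i, 0 ≤ v i) :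
    IsCompletelyPositive (Matrix.vecMulVec v v) :=
  of_fintype (Matrix.replicateCol Unit v) (fun i _ => hv i) (by
    ext i j
    simp [Matrix.vecMulVec_apply, Matrix.mul_apply])

theorem diagonal {d : Fin n → ℝ} (hd : ∀ i, 0 ≤ d i) :
    IsCompletelyPositive (Matrix.diagonal d) :=
  ⟨n, Matrix.diagonal fun i => √(d i), fun i j => by
    rw [Matrix.diagonal_apply]; split_ifs <;> positivity, by
    simp [Matrix.diagonal_mul_diagonal, Real.mul_self_sqrt (hd _)]⟩

theorem posSemidef {M : Matrix (Fin n) (Fin n) ℝ} (hM : IsCompletelyPositive M) :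
    M.PosSemidef := by
  obtain ⟨k, B, -, rfl⟩ := hM
  simpa [Matrix.conjTranspose_eq_transpose_of_trivial] using
    Matrix.posSemidef_self_mul_conjTranspose B

/-- A symmetric matrix annihilating `x` is completely positive if it dominates a completely positive
matrix annihilating `x`, with off-diagonal equality outside the positions of opposite signs. -/
theorem of_le {x : Fin n → ℝ} {M N : Matrix (Fin n) (Fin n) ℝ} (hN : IsCompletelyPositive N)
    (hMs : ∀ j k, M j k = M k j) (hNs : ∀ j k, N j k = N k j)
    (hMx : ∀ j, ∑ k, M j k * x k = 0) (hNx : ∀ j, ∑ k, N j k * x k = 0)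
    (heq : ∀ j k, j ≠ k → 0 ≤ x j * x k → N j k = M j k)
    (hle : ∀ j k, x j * x k < 0 → N j k ≤ M j k)
    (hdiag : ∀ j, x j = 0 → N j j ≤ M j j) : IsCompletelyPositive M := by
  -- The factor 2 is there because `(p, q)` and `(q, p)` both contribute to `D`.
  set c : Fin n → Fin n → ℝ := fun j k =>
    if x j * x k < 0 then (M j k - N j k) / (2 * (|x j| * |x k|)) else 0 with hc
  have hc0 : ∀ j k, 0 ≤ c j k := fun j k => by
    simp only [hc]
    split_ifs with h
    · exact div_nonneg (sub_nonneg.2 (hle j k h)) (by positivity)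
    · exact le_rfl
  have hcs : ∀ j k, c j k = c k j := fun j k => by
    simp only [hc, hMs j k, hNs j k, mul_comm (x j) (x k), mul_comm |x j| |x k|]
  set u : Fin n → Fin n → Fin n → ℝ := fun p q j =>
    |x q| * (if p = j then 1 else 0) + |x p| * (if q = j then 1 else 0) with hu
  set D : Matrix (Fin n) (Fin n) ℝ := ∑ p, ∑ q, c p q • Matrix.vecMulVec (u p q) (u p q) with hD
  have hDcp : IsCompletelyPositive D :=
    sum _ fun p _ => sum _ fun q _ => smul (hc0 p q) <| vecMulVec fun j => by
      simp only [hu]; split_ifs <;> positivity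
  have hDapp : ∀ j k, D j k = ∑ p, ∑ q, c p q * (u p q j * u p q k) := fun j k => by
    simp [hD, Matrix.sum_apply, Matrix.vecMulVec_apply]
  have hDx : ∀ j, ∑ k, D j k * x k = 0 := fun j => by
    simp only [hDapp, Finset.sum_mul]
    rw [Finset.sum_comm]
    refine Finset.sum_eq_zero fun p _ => ?_
    rw [Finset.sum_comm]
    refine Finset.sum_eq_zero fun q _ => ?_
    have h1 : ∑ k, u p q k * x k = |x q| * x p + |x p| * x q := by
      simp [hu, add_mul, Finset.sum_add_distrib]
    have h2 : c p q * (|x q| * x p + |x p| * x q) = 0 := by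
      simp only [hc]
      split_ifs with h
      · rcases mul_neg_iff.1 h with ⟨h1, h2⟩ | ⟨h1, h2⟩
        · rw [abs_of_pos h1, abs_of_neg h2]; ring
        · rw [abs_of_neg h1, abs_of_pos h2]; ring
      · simp
    calc ∑ k, c p q * (u p q j * u p q k) * x k
        = u p q j * (c p q * ∑ k, u p q k * x k) := by
          rw [Finset.mul_sum, Finset.mul_sum]
          exact Finset.sum_congr rfl fun k _ => by ring
      _ = 0 := by rw [h1, h2, mul_zero]
  have hDoff : ∀ j k, j ≠ k → D j k = M j k - N j k := fun j k hjk => by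
    have h1 : ∀ p q, c p q * (u p q j * u p q k) =
        (if p = j then if q = k then c p q * (|x p| * |x q|) else 0 else 0) +
        (if p = k then if q = j then c p q * (|x p| * |x q|) else 0 else 0) := fun p q => by
      simp only [ite_ite_eq_mul_ite, hu]
      linear_combination c p q * (|x q| ^ 2 * ite_mul_ite_of_ne hjk p +
        |x p| ^ 2 * ite_mul_ite_of_ne hjk q)
    rw [hDapp]
    simp only [h1, Finset.sum_add_distrib]
    simp only [Finset.sum_ite_eq', Finset.mem_univ, if_true, Finset.sum_ite_irrel,
      Finset.sum_const_zero]
    rw [hcs k j, mul_comm |x k|]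
    simp only [hc]
    split_ifs with h
    · have : x j ≠ 0 := by rintro h0; simp [h0] at h
      have : x k ≠ 0 := by rintro h0; simp [h0] at h
      field_simp
      ring
    · rw [heq j k hjk (not_lt.1 h)]; ring
  have hDdiag : ∀ j, x j = 0 → D j j = 0 := fun j hj => by
    rw [hDapp]
    refine Finset.sum_eq_zero fun p _ => Finset.sum_eq_zero fun q _ => ?_
    simp only [hu, hc]
    by_cases hp : p = j
    · subst hp; simp [hj]
    · by_cases hq : q = j
      · subst hq; simp [hj]
      · simp [hp, hq]
  have hE : M = N + D + Matrix.diagonal fun j => M j j - N j j - D j j := by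
    ext j k
    by_cases hjk : j = k
    · subst hjk; simp
    · simp [hjk, hDoff j k hjk]
  rw [hE]
  refine (hN.add hDcp).add (diagonal fun j => ?_)
  -- `M - N - D` is diagonal and annihilates `x`.
  have hEx : (M j j - N j j - D j j) * x j = 0 := by
    have h : ∑ k, (M j k - N j k - D j k) * x k = 0 := by
      simp [sub_mul, Finset.sum_sub_distrib, hMx, hNx, hDx]
    rwa [Finset.sum_eq_single j (fun k _ hk => by rw [hDoff j k hk.symm]; ring)
      (by simp)] at h
  rcases mul_eq_zero.1 hEx with h | h
  · exact h.ge
  · have := hdiag j h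
    rw [hDdiag j h]
    linarith

end IsCompletelyPositive

/-! ### Rank-one sums over triples, and their entries for symmetric `x`. -/

section TripleSum

variable {n : ℕ} (x : Fin n → ℝ)

/-- A non-negative vector supported on `{i, p, q}`; it is orthogonal to `x` as soon as
`x p` and `x q` do not have the sign of `x i`. -/
noncomputable def tripleVec (i p q : Fin n) : Fin n → ℝ := fun j =>
  |x i| * ((if p = j then 1 else 0) + (if q = j then 1 else 0)) +
    (|x p| + |x q|) * (if i = j then 1 else 0)

/-- Twice the indicator of `x i` and `x p` having opposite signs, with value `1` if one of them
vanishes. -/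
noncomputable def oppositeWeight (i p : Fin n) : ℝ := 1 - Real.sign (x i) * Real.sign (x p)

/-- The square produces the squared distance at position `(p, q)`. The factor `|x i|` turns the
coefficient `x i ^ 2` there into `|x i| ^ 3`, and removes the case `x i = 0`, in which `x p` and `x
q` could have opposite signs. -/
noncomputable def tripleWeight (i p q : Fin n) : ℝ :=
  oppositeWeight x i p * oppositeWeight x i q * (x p - x q) ^ 2 * |x i|

noncomputable def tripleSum : Matrix (Fin n) (Fin n) ℝ :=
  ∑ i, ∑ p, ∑ q, tripleWeight x i p q •
    Matrix.vecMulVec (tripleVec x i p q) (tripleVec x i p q)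

theorem tripleSum_apply (j k : Fin n) : tripleSum x j k =
    ∑ i, ∑ p, ∑ q, tripleWeight x i p q * (tripleVec x i p q j * tripleVec x i p q k) := by
  simp [tripleSum, Matrix.sum_apply, Matrix.vecMulVec_apply]

theorem tripleSum_symm (j k : Fin n) : tripleSum x j k = tripleSum x k j := by
  simp only [tripleSum_apply, mul_comm (tripleVec x _ _ _ j)]

theorem oppositeWeight_nonneg (i p : Fin n) : 0 ≤ oppositeWeight x i p := by
  unfold oppositeWeight
  rcases Real.sign_apply_eq (x i) with h | h | h <;>
    rcases Real.sign_apply_eq (x p) with h' | h' | h' <;> rw [h, h'] <;> norm_num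

theorem oppositeWeight_comm (i p : Fin n) : oppositeWeight x i p = oppositeWeight x p i := by
  rw [oppositeWeight, oppositeWeight, mul_comm]

theorem oppositeWeight_of_mul_pos {i p : Fin n} (h : 0 < x i * x p) :
    oppositeWeight x i p = 0 := by
  unfold oppositeWeight
  rcases mul_pos_iff.1 h with ⟨h1, h2⟩ | ⟨h1, h2⟩
  · simp [Real.sign_of_pos h1, Real.sign_of_pos h2]
  · simp [Real.sign_of_neg h1, Real.sign_of_neg h2]

theorem oppositeWeight_of_mul_neg {i p : Fin n} (h : x i * x p < 0) :
    oppositeWeight x i p = 2 := by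
  unfold oppositeWeight
  rcases mul_neg_iff.1 h with ⟨h1, h2⟩ | ⟨h1, h2⟩
  · rw [Real.sign_of_pos h1, Real.sign_of_neg h2]; norm_num
  · rw [Real.sign_of_neg h1, Real.sign_of_pos h2]; norm_num

theorem oppositeWeight_of_left {i p : Fin n} (h : x i = 0) : oppositeWeight x i p = 1 := by
  simp [oppositeWeight, h]

theorem oppositeWeight_of_right {i p : Fin n} (h : x p = 0) : oppositeWeight x i p = 1 := by
  simp [oppositeWeight, h]

theorem tripleWeight_nonneg (i p q : Fin n) : 0 ≤ tripleWeight x i p q := by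
  have := oppositeWeight_nonneg x i p
  have := oppositeWeight_nonneg x i q
  unfold tripleWeight
  positivity

theorem tripleWeight_symm (i p q : Fin n) : tripleWeight x i p q = tripleWeight x i q p := by
  unfold tripleWeight; ring

theorem tripleVec_nonneg (i p q j : Fin n) : 0 ≤ tripleVec x i p q j := by
  unfold tripleVec
  split_ifs <;> positivity

theorem isCompletelyPositive_tripleSum : IsCompletelyPositive (tripleSum x) :=
  .sum _ fun i _ => .sum _ fun p _ => .sum _ fun q _ =>
    .smul (tripleWeight_nonneg x i p q) (.vecMulVec (tripleVec_nonneg x i p q))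

theorem oppositeWeight_mul_abs_add (i p : Fin n) :
    oppositeWeight x i p * (|x i| * x p + |x p| * x i) = 0 := by
  rcases lt_or_ge 0 (x i * x p) with h | h
  · rw [oppositeWeight_of_mul_pos x h, zero_mul]
  · rcases mul_nonpos_iff.1 h with ⟨h1, h2⟩ | ⟨h1, h2⟩
    · rw [abs_of_nonneg h1, abs_of_nonpos h2]; ring
    · rw [abs_of_nonpos h1, abs_of_nonneg h2]; ring

theorem tripleSum_mul (j : Fin n) : ∑ k, tripleSum x j k * x k = 0 := by
  simp only [tripleSum_apply, Finset.sum_mul]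
  rw [Finset.sum_comm]
  refine Finset.sum_eq_zero fun i _ => ?_
  rw [Finset.sum_comm]
  refine Finset.sum_eq_zero fun p _ => ?_
  rw [Finset.sum_comm]
  refine Finset.sum_eq_zero fun q _ => ?_
  have h1 : ∑ k, tripleVec x i p q k * x k =
      (|x i| * x p + |x p| * x i) + (|x i| * x q + |x q| * x i) := by
    simp only [tripleVec, add_mul, mul_add, Finset.sum_add_distrib, mul_assoc, ite_mul, one_mul,
      zero_mul, mul_ite, mul_zero, Finset.sum_ite_eq, Finset.mem_univ, if_true]
    ring
  calc ∑ k, tripleWeight x i p q * (tripleVec x i p q j * tripleVec x i p q k) * x k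
      = tripleWeight x i p q * tripleVec x i p q j * ∑ k, tripleVec x i p q k * x k := by
        rw [Finset.mul_sum]
        exact Finset.sum_congr rfl fun k _ => by ring
    _ = 0 := by
        rw [h1, tripleWeight]
        linear_combination
          oppositeWeight x i q * (x p - x q) ^ 2 * |x i| * tripleVec x i p q j *
            oppositeWeight_mul_abs_add x i p +
          oppositeWeight x i p * (x p - x q) ^ 2 * |x i| * tripleVec x i p q j *
            oppositeWeight_mul_abs_add x i q

theorem tripleSum_apply_of_ne {j k : Fin n} (hjk : j ≠ k) : tripleSum x j k =
    2 * ∑ i, tripleWeight x i j k * x i ^ 2 +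
    2 * ∑ q, tripleWeight x k j q * (|x k| * (|x j| + |x q|)) +
    2 * ∑ q, tripleWeight x j k q * (|x j| * (|x k| + |x q|)) := by
  have h : ∀ i p q, tripleWeight x i p q * (tripleVec x i p q j * tripleVec x i p q k) =
      (if p = j then if q = k then tripleWeight x i p q * x i ^ 2 else 0 else 0) +
      (if p = k then if q = j then tripleWeight x i p q * x i ^ 2 else 0 else 0) +
      (if i = k then if p = j then tripleWeight x i p q * (|x i| * (|x p| + |x q|)) else 0 else 0) +
      (if i = k then if q = j then tripleWeight x i p q * (|x i| * (|x p| + |x q|)) else 0 else 0) +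
      (if i = j then if p = k then tripleWeight x i p q * (|x i| * (|x p| + |x q|)) else 0 else 0) +
      (if i = j then if q = k then tripleWeight x i p q * (|x i| * (|x p| + |x q|)) else 0 else 0)
      := fun i p q => by
    simp only [ite_ite_eq_mul_ite, tripleVec]
    rw [← sq_abs (x i)]
    linear_combination tripleWeight x i p q * (|x i| ^ 2 * (ite_mul_ite_of_ne hjk p + ite_mul_ite_of_ne hjk q) +
      (|x p| + |x q|) ^ 2 * ite_mul_ite_of_ne hjk i)
  rw [tripleSum_apply]
  simp only [h, Finset.sum_add_distrib]
  simp only [Finset.sum_ite_eq', Finset.mem_univ, if_true, Finset.sum_ite_irrel,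
      Finset.sum_const_zero]
  have h1 : ∑ i, tripleWeight x i k j * x i ^ 2 = ∑ i, tripleWeight x i j k * x i ^ 2 :=
    Finset.sum_congr rfl fun i _ => by rw [tripleWeight_symm]
  have h2 : ∀ i r, ∑ p, tripleWeight x i p r * (|x i| * (|x p| + |x r|)) =
      ∑ q, tripleWeight x i r q * (|x i| * (|x r| + |x q|)) := fun i r =>
    Finset.sum_congr rfl fun q _ => by rw [tripleWeight_symm, add_comm |x q|]
  rw [h1, h2, h2]
  ring

variable {x}

theorem sum_eq_zero_of_odd (hx : ∀ i, x i.rev = -x i) {g : ℝ → ℝ} (hg : ∀ t, g (-t) = -g t) :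
    ∑ i, g (x i) = 0 := by
  have h : ∑ i, g (x i) = ∑ i, g (x (Fin.revPerm i)) := (Equiv.sum_comp Fin.revPerm _).symm
  simp only [Fin.revPerm_apply, hx, hg, Finset.sum_neg_distrib] at h
  linarith

/-- The sign part of the weight is odd in `x q`, so by symmetry the weight averages to 1 against
functions of `|x q|`. -/
theorem sum_oppositeWeight_mul (hx : ∀ i, x i.rev = -x i) (k : Fin n) (g : ℝ → ℝ) :
    ∑ q, oppositeWeight x k q * g |x q| = ∑ q, g |x q| := by
  have h := sum_eq_zero_of_odd hx (g := fun t => Real.sign t * g |t|)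
    (fun t => by simp [Real.sign_neg])
  simp only [oppositeWeight, sub_mul, one_mul, Finset.sum_sub_distrib, mul_assoc, ← Finset.mul_sum,
    h, mul_zero, sub_zero]

theorem sum_oppositeWeight_mul_cube (hx : ∀ i, x i.rev = -x i) (j k : Fin n) :
    ∑ i, oppositeWeight x i j * oppositeWeight x i k * |x i| ^ 3 =
      (1 + Real.sign (x j) * Real.sign (x k)) * ∑ i, |x i| ^ 3 := by
  have h := sum_eq_zero_of_odd hx (g := fun t => Real.sign t * |t| ^ 3)
    (fun t => by simp [Real.sign_neg])
  have hs : ∀ t : ℝ, Real.sign t ^ 2 * |t| ^ 3 = |t| ^ 3 := fun t => by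
    rcases lt_trichotomy t 0 with ht | rfl | ht
    · simp [Real.sign_of_neg ht]
    · simp
    · simp [Real.sign_of_pos ht]
  calc _ = ∑ i, ((1 + Real.sign (x j) * Real.sign (x k)) * |x i| ^ 3 -
        (Real.sign (x j) + Real.sign (x k)) * (Real.sign (x i) * |x i| ^ 3)) := by
        refine Finset.sum_congr rfl fun i _ => ?_
        unfold oppositeWeight
        linear_combination Real.sign (x j) * Real.sign (x k) * hs (x i)
    _ = _ := by
        rw [Finset.sum_sub_distrib, ← Finset.mul_sum, ← Finset.mul_sum, h]; ring

/-- If neither weight nor `x k` vanishes, `x j` and `x q` cannot have opposite signs. Passing to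
absolute values makes `sum_oppositeWeight_mul` applicable. -/
theorem oppositeWeight_mul_sub_sq (j k q : Fin n) :
    oppositeWeight x k j * oppositeWeight x k q * (x j - x q) ^ 2 * |x k| =
      oppositeWeight x k j * oppositeWeight x k q * (|x j| - |x q|) ^ 2 * |x k| := by
  rcases eq_or_ne (x k) 0 with hk | hk
  · simp [hk]
  have key : oppositeWeight x k j * oppositeWeight x k q * (x j * x q - |x j| * |x q|) = 0 := by
    have hk' : |x k| ^ 2 ≠ 0 := by positivity
    refine (mul_eq_zero.1 ?_).resolve_left hk'
    linear_combination oppositeWeight x k q * |x k| * x q * oppositeWeight_mul_abs_add x k j -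
      oppositeWeight x k j * |x j| * x k * oppositeWeight_mul_abs_add x k q -
      oppositeWeight x k j * oppositeWeight x k q * |x j| * |x q| * sq_abs (x k)
  linear_combination -2 * |x k| * key - oppositeWeight x k j * oppositeWeight x k q * |x k| *
    (sq_abs (x j) + sq_abs (x q))

theorem sum_tripleWeight_mul (hx : ∀ i, x i.rev = -x i) (j k : Fin n) :
    ∑ q, tripleWeight x k j q * (|x k| * (|x j| + |x q|)) =
      oppositeWeight x k j * x k ^ 2 *
        (n * |x j| ^ 3 - |x j| ^ 2 * ∑ q, |x q| - |x j| * ∑ q, x q ^ 2 + ∑ q, |x q| ^ 3) := by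
  have h := sum_oppositeWeight_mul hx k fun t => (|x j| - t) ^ 2 * (|x j| + t)
  have h2 : ∑ q, (|x j| - |x q|) ^ 2 * (|x j| + |x q|) =
      n * |x j| ^ 3 - |x j| ^ 2 * ∑ q, |x q| - |x j| * ∑ q, x q ^ 2 + ∑ q, |x q| ^ 3 := by
    calc _ = ∑ q, (|x j| ^ 3 - |x j| ^ 2 * |x q| - |x j| * x q ^ 2 + |x q| ^ 3) :=
          Finset.sum_congr rfl fun q _ => by rw [← sq_abs (x q)]; ring
      _ = _ := by
          simp [Finset.sum_add_distrib, Finset.sum_sub_distrib, Finset.mul_sum]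
  rw [← h2, ← h, Finset.mul_sum]
  refine Finset.sum_congr rfl fun q _ => ?_
  rw [tripleWeight, oppositeWeight_mul_sub_sq, ← sq_abs (x k)]
  ring

theorem tripleSum_apply_of_ne_of_odd (hx : ∀ i, x i.rev = -x i) {j k : Fin n} (hjk : j ≠ k) :
    tripleSum x j k =
      2 * (x j - x k) ^ 2 * (1 + Real.sign (x j) * Real.sign (x k)) * ∑ i, |x i| ^ 3 +
      2 * oppositeWeight x j k *
        (x k ^ 2 * (n * |x j| ^ 3 - |x j| ^ 2 * ∑ q, |x q| - |x j| * ∑ q, x q ^ 2 +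
            ∑ q, |x q| ^ 3) +
          x j ^ 2 * (n * |x k| ^ 3 - |x k| ^ 2 * ∑ q, |x q| - |x k| * ∑ q, x q ^ 2 +
            ∑ q, |x q| ^ 3)) := by
  have h : ∑ i, tripleWeight x i j k * x i ^ 2 = (x j - x k) ^ 2 *
      ∑ i, oppositeWeight x i j * oppositeWeight x i k * |x i| ^ 3 := by
    rw [Finset.mul_sum]
    refine Finset.sum_congr rfl fun i _ => ?_
    rw [tripleWeight, ← sq_abs (x i)]
    ring
  rw [tripleSum_apply_of_ne x hjk, h, sum_oppositeWeight_mul_cube hx, sum_tripleWeight_mul hx,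
    sum_tripleWeight_mul hx, oppositeWeight_comm x k j]
  ring

theorem tripleSum_apply_self_of_eq_zero (hx : ∀ i, x i.rev = -x i) {j : Fin n} (hj : x j = 0) :
    tripleSum x j j = 2 * (∑ i, |x i| ^ 3) * ∑ q, x q ^ 2 := by
  -- The overlaps `i = j` and `p = q` have weight zero.
  have h : ∀ i p q, tripleWeight x i p q * (tripleVec x i p q j * tripleVec x i p q j) =
      (if p = j then tripleWeight x i p q * x i ^ 2 else 0) +
      (if q = j then tripleWeight x i p q * x i ^ 2 else 0) := fun i p q => by
    by_cases hi : i = j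
    · subst hi
      simp [tripleWeight, hj]
    by_cases hp : p = j
    · subst hp
      by_cases hq : q = p
      · subst hq
        simp [tripleWeight]
      · simp [tripleVec, hi, hq, abs_mul_abs_self, sq]
    · by_cases hq : q = j
      · subst hq
        simp [tripleVec, hi, hp, abs_mul_abs_self, sq]
      · simp [tripleVec, hi, hp, hq]
  have h1 : ∀ i, ∑ q, tripleWeight x i j q * x i ^ 2 = |x i| ^ 3 * ∑ q, x q ^ 2 := fun i => by
    have := sum_oppositeWeight_mul hx i fun t => t ^ 2
    simp only [sq_abs] at this
    rw [← this, Finset.mul_sum]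
    refine Finset.sum_congr rfl fun q _ => ?_
    rw [tripleWeight, oppositeWeight_of_right x hj, hj, ← sq_abs (x i)]
    ring
  rw [tripleSum_apply]
  simp only [h, Finset.sum_add_distrib]
  simp only [Finset.sum_ite_eq', Finset.mem_univ, if_true, Finset.sum_ite_irrel,
    Finset.sum_const_zero, tripleWeight_symm x _ _ j, h1]
  rw [← Finset.sum_mul]
  ring

/-- The difference of the two sides is `a * b` times a form linear in the power sums. Summing `|x q|
* (|x q| - b) ^ 2 ≥ 0` bounds the first and third absolute moments below by the second; `ha` then
absorbs the term with `n`. -/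
theorem cross_sum_le {a b : ℝ} (hb : 0 ≤ b) (hba : b ≤ a)
    (ha : n * a ^ 2 ≤ 3 * ∑ i, x i ^ 2) :
    b ^ 2 * (n * a ^ 3 - a ^ 2 * ∑ q, |x q| - a * ∑ q, x q ^ 2 + ∑ q, |x q| ^ 3) +
      a ^ 2 * (n * b ^ 3 - b ^ 2 * ∑ q, |x q| - b * ∑ q, x q ^ 2 + ∑ q, |x q| ^ 3) ≤
    (a + b) ^ 2 * ∑ q, |x q| ^ 3 := by
  have h1 : 2 * b * ∑ q, x q ^ 2 ≤ ∑ q, |x q| ^ 3 + b ^ 2 * ∑ q, |x q| := by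
    rw [Finset.mul_sum, Finset.mul_sum, ← Finset.sum_add_distrib]
    refine Finset.sum_le_sum fun q _ => ?_
    rw [← sq_abs (x q)]
    nlinarith [mul_nonneg (abs_nonneg (x q)) (sq_nonneg (|x q| - b))]
  have hT1 : 0 ≤ ∑ q, |x q| := Finset.sum_nonneg fun q _ => abs_nonneg _
  have hT2 : 0 ≤ ∑ q, x q ^ 2 := Finset.sum_nonneg fun q _ => sq_nonneg _
  set T1 := ∑ q, |x q|
  set T2 := ∑ q, x q ^ 2
  set T3 := ∑ q, |x q| ^ 3
  have ha0 : 0 ≤ a := hb.trans hba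
  have h2 : n * (a * b * (a + b)) ≤ T2 * (a + 5 * b) := by
    rcases ha0.eq_or_lt with h0 | h0
    · have : b = 0 := le_antisymm (h0 ▸ hba) hb
      simp [← h0, this]
    -- The difference is `a * (a - b) * (a + 3 * b) / 3`.
    have h3 : a * b * (a + b) ≤ a ^ 2 * (a + 5 * b) / 3 := by
      nlinarith [mul_nonneg ha0 (mul_nonneg (sub_nonneg.2 hba) (by positivity : 0 ≤ a + 3 * b))]
    calc (n : ℝ) * (a * b * (a + b)) ≤ n * (a ^ 2 * (a + 5 * b) / 3) := by gcongr
      _ = n * a ^ 2 * (a + 5 * b) / 3 := by ring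
      _ ≤ 3 * T2 * (a + 5 * b) / 3 := by gcongr
      _ = T2 * (a + 5 * b) := by ring
  have h4 : b * b * T1 ≤ a * b * T1 := by gcongr
  have h5 : 0 ≤ a * b * (2 * T3 + 2 * (a * b * T1) + T2 * (a + b) - n * (a * b * (a + b))) :=
    mul_nonneg (mul_nonneg ha0 hb) (by nlinarith)
  linarith

end TripleSum

/-! ### Complete positivity for symmetric points of bounded spread. -/

section SymmetricPoints

variable {n : ℕ} {x : Fin n → ℝ}

/-- The squared distance matrix of a symmetric family of points on the line that is not too spread
out becomes completely positive once its least eigenvalue is shifted to `0`. -/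
theorem isCompletelyPositive_sq_sub_add (hx : ∀ i, x i.rev = -x i)
    (hbd : ∀ i, n * x i ^ 2 ≤ 3 * ∑ k, x k ^ 2) :
    IsCompletelyPositive ((Matrix.of fun j k => (x j - x k) ^ 2) +
      (2 * ∑ k, x k ^ 2) • (1 : Matrix (Fin n) (Fin n) ℝ)) := by
  have hT2 : 0 ≤ ∑ q, x q ^ 2 := Finset.sum_nonneg fun q _ => sq_nonneg _
  -- The normalisation divides by this sum; if it is zero, all points coincide at `0` and the matrix
  -- is zero.
  rcases (Finset.sum_nonneg fun q _ => by positivity : 0 ≤ ∑ q, |x q| ^ 3).eq_or_lt with h0 | hT3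
  · have h : ∀ q, x q = 0 := fun q => by
      have := (Finset.sum_eq_zero_iff_of_nonneg fun q _ => by positivity).1 h0.symm q
        (Finset.mem_univ q)
      simpa using this
    convert IsCompletelyPositive.zero (n := n)
    ext j k
    simp [h]
  have hoff : ∀ j k, j ≠ k → (4 * ∑ q, |x q| ^ 3)⁻¹ * tripleSum x j k = (1 / 2) *
      ((x j - x k) ^ 2 * (1 + Real.sign (x j) * Real.sign (x k)) + oppositeWeight x j k *
        (x k ^ 2 * (n * |x j| ^ 3 - |x j| ^ 2 * ∑ q, |x q| - |x j| * ∑ q, x q ^ 2 +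
            ∑ q, |x q| ^ 3) +
          x j ^ 2 * (n * |x k| ^ 3 - |x k| ^ 2 * ∑ q, |x q| - |x k| * ∑ q, x q ^ 2 +
            ∑ q, |x q| ^ 3)) / ∑ q, |x q| ^ 3) := fun j k hjk => by
    rw [tripleSum_apply_of_ne_of_odd hx hjk]
    field_simp
    ring
  refine IsCompletelyPositive.of_le (x := x)
    (N := (4 * ∑ q, |x q| ^ 3)⁻¹ • tripleSum x)
    (.smul (by positivity) (isCompletelyPositive_tripleSum x)) ?_ ?_ ?_ ?_ ?_ ?_ ?_
  · intro j k
    simp only [Matrix.add_apply, Matrix.of_apply, Matrix.smul_apply, Matrix.one_apply, smul_eq_mul,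
      eq_comm (a := k)]
    ring
  · intro j k
    simp only [Matrix.smul_apply, tripleSum_symm x j k]
  · intro j
    have h1 := sum_eq_zero_of_odd hx (g := fun t => t) fun _ => rfl
    have h3 := sum_eq_zero_of_odd hx (g := fun t => t ^ 3) fun t => by ring
    calc _ = ∑ k, (x j ^ 2 * x k - 2 * x j * x k ^ 2 + x k ^ 3 +
          if j = k then (2 * ∑ k, x k ^ 2) * x k else 0) := by
          refine Finset.sum_congr rfl fun k _ => ?_
          simp only [Matrix.add_apply, Matrix.of_apply, Matrix.smul_apply, Matrix.one_apply,
            smul_eq_mul]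
          split_ifs <;> ring
      _ = 0 := by
          rw [Finset.sum_add_distrib, Finset.sum_add_distrib, Finset.sum_sub_distrib,
            ← Finset.mul_sum, ← Finset.mul_sum, h1, h3, Finset.sum_ite_eq]
          simp only [Finset.mem_univ, if_true]
          ring
  · intro j
    simp only [Matrix.smul_apply, smul_eq_mul, mul_assoc, ← Finset.mul_sum, tripleSum_mul, mul_zero]
  · intro j k hjk h
    rw [Matrix.smul_apply, smul_eq_mul, hoff j k hjk]
    simp only [Matrix.add_apply, Matrix.of_apply, Matrix.smul_apply, Matrix.one_apply_ne hjk,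
      smul_zero, add_zero]
    -- If one point is `0`, both summands in `hoff` equal the square of the other, so the factor `1
    -- / 2` gives exact equality.
    rcases h.eq_or_lt with h | h
    · rcases mul_eq_zero.1 h.symm with h | h
      · rw [oppositeWeight_of_left x h, h]
        simp
        field_simp
        ring
      · rw [oppositeWeight_of_right x h, h]
        simp
        field_simp
        ring
    · have hs := oppositeWeight_of_mul_pos x h
      rw [hs]
      unfold oppositeWeight at hs
      linear_combination -(1 / 2) * (x j - x k) ^ 2 * hs
  · intro j k h
    have hjk : j ≠ k := by
      rintro rfl
      exact absurd h (not_lt.2 (mul_self_nonneg _))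
    rw [Matrix.smul_apply, smul_eq_mul, hoff j k hjk]
    simp only [Matrix.add_apply, Matrix.of_apply, Matrix.smul_apply, Matrix.one_apply_ne hjk,
      smul_zero, add_zero]
    have hs := oppositeWeight_of_mul_neg x h
    have hs' : 1 + Real.sign (x j) * Real.sign (x k) = 0 := by
      unfold oppositeWeight at hs
      linarith
    have hsq : (x j - x k) ^ 2 = (|x j| + |x k|) ^ 2 := by
      rcases mul_neg_iff.1 h with ⟨h1, h2⟩ | ⟨h1, h2⟩
      · rw [abs_of_pos h1, abs_of_neg h2]; ring
      · rw [abs_of_neg h1, abs_of_pos h2]; ring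
    rw [hs, hs', hsq, mul_zero, zero_add, mul_div_assoc, ← mul_assoc, one_div,
      inv_mul_cancel₀ two_ne_zero, one_mul, div_le_iff₀ hT3, ← sq_abs (x j), ← sq_abs (x k)]
    rcases le_total |x k| |x j| with hle | hle
    · exact cross_sum_le (abs_nonneg _) hle (by rw [sq_abs]; exact hbd j)
    · have := cross_sum_le (abs_nonneg _) hle (by rw [sq_abs]; exact hbd k)
      linarith
  · intro j hj
    rw [Matrix.smul_apply, smul_eq_mul, tripleSum_apply_self_of_eq_zero hx hj]
    simp only [Matrix.add_apply, Matrix.of_apply, Matrix.smul_apply, Matrix.one_apply_eq, sub_self,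
      smul_eq_mul]
    have : (4 * ∑ q, |x q| ^ 3)⁻¹ * (2 * (∑ i, |x i| ^ 3) * ∑ q, x q ^ 2) =
        (∑ q, x q ^ 2) / 2 := by
      field_simp
      ring
    rw [this]
    linarith

end SymmetricPoints

/-! ### The centered integers, and optimality of the shift. -/

section Centered

/-- The points `1, …, n` translated so that their mean is `0`. -/
noncomputable def centeredPoint (n : ℕ) (i : Fin n) : ℝ := (i : ℕ) - ((n : ℝ) - 1) / 2

theorem centeredPoint_rev {n : ℕ} (i : Fin n) : centeredPoint n i.rev = -centeredPoint n i := by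
  have h : ((i.rev : ℕ) : ℝ) = n - (i + 1) := by
    rw [Fin.val_rev, Nat.cast_sub (by omega)]; push_cast; ring
  rw [centeredPoint, centeredPoint, h]
  ring

theorem two_mul_sum_centeredPoint_sq (n : ℕ) :
    2 * ∑ i, centeredPoint n i ^ 2 = optimalShift n := by
  have h : ∀ (c : ℝ) (m : ℕ), ∑ i ∈ Finset.range m, ((i : ℝ) - c) ^ 2 =
      m * (m - 1) * (2 * m - 1) / 6 - c * m * (m - 1) + m * c ^ 2 := fun c m => by
    induction m with
    | zero => simp
    | succ m ih => rw [Finset.sum_range_succ, ih]; push_cast; ring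
  have h' := Fin.sum_univ_eq_sum_range (fun i => ((i : ℝ) - ((n : ℝ) - 1) / 2) ^ 2) n
  simp only [centeredPoint, optimalShift]
  rw [h', h]
  ring

/-- The extreme points satisfy `((n - 1) / 2) ^ 2 ≤ (n ^ 2 - 1) / 4`, and the right side is `n * (n
^ 2 - 1) / 4`. -/
theorem card_mul_centeredPoint_sq_le {n : ℕ} (i : Fin n) :
    n * centeredPoint n i ^ 2 ≤ 3 * ∑ k, centeredPoint n k ^ 2 := by
  have h := two_mul_sum_centeredPoint_sq n
  have hn : (1 : ℝ) ≤ n := by exact_mod_cast i.pos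
  have hi : ((i : ℕ) : ℝ) ≤ n - 1 := by
    rw [le_sub_iff_add_le]; exact_mod_cast i.isLt
  have hi0 : (0 : ℝ) ≤ (i : ℕ) := Nat.cast_nonneg _
  have h1 : centeredPoint n i ^ 2 ≤ (n ^ 2 - 1) / 4 := by
    unfold centeredPoint
    nlinarith [mul_nonneg hi0 (sub_nonneg.2 hi)]
  have h2 : (n : ℝ) * centeredPoint n i ^ 2 ≤ n * ((n ^ 2 - 1) / 4) := by gcongr
  unfold optimalShift at h
  linarith

theorem distMatrix_eq (n : ℕ) :
    distMatrix n = Matrix.of fun j k => (centeredPoint n j - centeredPoint n k) ^ 2 := by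
  ext j k
  simp only [distMatrix, centeredPoint, Matrix.of_apply]
  ring

theorem isCompletelyPositive_shiftedDistMatrix (n : ℕ) :
    IsCompletelyPositive (shiftedDistMatrix n) := by
  rw [shiftedDistMatrix, distMatrix_eq, ← two_mul_sum_centeredPoint_sq]
  exact isCompletelyPositive_sq_sub_add centeredPoint_rev card_mul_centeredPoint_sq_le

theorem distMatrix_mulVec_centeredPoint (n : ℕ) :
    (distMatrix n).mulVec (centeredPoint n) = -optimalShift n • centeredPoint n := by
  have h1 := sum_eq_zero_of_odd (centeredPoint_rev (n := n)) (g := fun t => t) fun _ => rfl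
  have h3 := sum_eq_zero_of_odd (centeredPoint_rev (n := n)) (g := fun t => t ^ 3) fun t => by ring
  ext j
  rw [distMatrix_eq, ← two_mul_sum_centeredPoint_sq, Matrix.mulVec, dotProduct]
  calc _ = ∑ k, (centeredPoint n j ^ 2 * centeredPoint n k -
        2 * centeredPoint n j * centeredPoint n k ^ 2 + centeredPoint n k ^ 3) :=
        Finset.sum_congr rfl fun k _ => by rw [Matrix.of_apply]; ring
    _ = _ := by
        rw [Finset.sum_add_distrib, Finset.sum_sub_distrib, ← Finset.mul_sum, ← Finset.mul_sum,
          h1, h3, Pi.smul_apply, smul_eq_mul]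
        ring

theorem optimalShift_le_of_posSemidef {n : ℕ} (hn : 1 ≤ n) {c : ℝ}
    (hc : (distMatrix n + c • (1 : Matrix (Fin n) (Fin n) ℝ)).PosSemidef) :
    optimalShift n ≤ c := by
  -- For `n = 1` the centered point is `0` and useless as a test vector; the diagonal entry serves
  -- instead.
  rcases hn.eq_or_lt with rfl | hn
  · have := hc.diag_nonneg (i := 0)
    simpa [distMatrix, optimalShift] using this
  have h := hc.dotProduct_mulVec_nonneg (centeredPoint n)
  rw [Matrix.add_mulVec, distMatrix_mulVec_centeredPoint, Matrix.smul_mulVec, Matrix.one_mulVec,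
    ← add_smul, dotProduct_smul, star_trivial, smul_eq_mul] at h
  have hsq : centeredPoint n ⬝ᵥ centeredPoint n = ∑ i, centeredPoint n i ^ 2 :=
    Finset.sum_congr rfl fun i _ => (sq _).symm
  have hpos : 0 < centeredPoint n ⬝ᵥ centeredPoint n := by
    have h2 := two_mul_sum_centeredPoint_sq n
    have hn' : (1 : ℝ) < n := by exact_mod_cast hn
    have h3 : 0 < optimalShift n := by
      have : 0 < (n : ℝ) ^ 2 - 1 := by nlinarith
      unfold optimalShift
      positivity
    linarith
  have := nonneg_of_mul_nonneg_left h hpos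
  linarith

end Centered

theorem theorem4p5 (n : ℕ) (hn : 1 ≤ n) :
    IsCompletelyPositive (shiftedDistMatrix n) ∧
    IsLeast {c : ℝ | (distMatrix n + c • (1 : Matrix (Fin n) (Fin n) ℝ)).PosSemidef}
      (optimalShift n) ∧
    IsLeast {c : ℝ | IsCompletelyPositive
        (distMatrix n + c • (1 : Matrix (Fin n) (Fin n) ℝ))}
      (optimalShift n) := by
  have hcp : IsCompletelyPositive
      (distMatrix n + optimalShift n • (1 : Matrix (Fin n) (Fin n) ℝ)) :=
    isCompletelyPositive_shiftedDistMatrix n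
  exact ⟨hcp, ⟨hcp.posSemidef, fun c hc => optimalShift_le_of_posSemidef hn hc⟩,
    ⟨hcp, fun c hc => optimalShift_le_of_posSemidef hn
      (IsCompletelyPositive.posSemidef hc)⟩⟩
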